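/- Let $H$ be a separable complex Hilbert space and let $S,T\subseteq H$ be closed subspaces. Write $P_V$ for the orthogonal projection of $H$ onto a closed subspace $V$, $N(\cdot)$ for the nullspace of an operator, and $\dim V\in\{0,1,2,\dots\}\cup\{\infty\}$ for the Hilbert space dimension of a closed subspace $V$. Say that $S$ and $T$ have a common complement if there is a closed subspace $Z\subseteq H$ such that $H$ is the (not necessarily orthogonal) direct sum of $S$ and $Z$ and also the direct sum of $T$ and $Z$. Put $A=P_S-P_T$. (a) $S$ and $T$ have no common complement if and only if both of the following hold: (1) $\dim N(A-1)\neq\dim N(A+1)$; (2) the restriction of $A$ to $\left(N(A-1)\oplus N(A+1)\right)^{\perp}$ is a compact operator. (b) $S$ and $T$ have no common complement if and only if both of the following hold: (1) $\dim (S\cap T^{\perp})\neq\dim (S^{\perp}\cap T)$; (2) at least one of the operators $P_S P_{T^\perp}$ and $P_T P_{S^\perp}$ is compact on $H$. -/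

import Mathlib

/-- The dimension of a closed subspace of a separable Hilbert space, as an element of
`{0, 1, 2, …} ∪ {∞}` (in a separable space all infinite orthonormal bases are countable, so `∞` is
the only infinite value). -/
noncomputable def hdim {H : Type*} [NormedAddCommGroup H] [InnerProductSpace ℂ H]
    (V : Submodule ℂ H) : ℕ∞ :=
  Cardinal.toENat (Module.rank ℂ V)

/-- `S` and `T` have a common complement: there is a closed subspace `Z` such that `H` is the
(not necessarily orthogonal) direct sum of `S` and `Z`, and also of `T` and `Z`. -/
def HasCommonComplement {H : Type*} [NormedAddCommGroup H] [InnerProductSpace ℂ H]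
    (S T : Submodule ℂ H) : Prop :=
  ∃ Z : Submodule ℂ H, IsClosed (Z : Set H) ∧ IsCompl S Z ∧ IsCompl T Z

/-- The orthogonal projection of the Hilbert space `H` onto a closed subspace, as a bounded operator
on `H`. -/
noncomputable def orthProj {H : Type*} [NormedAddCommGroup H] [InnerProductSpace ℂ H]
    [CompleteSpace H] (S : ClosedSubmodule ℂ H) : H →L[ℂ] H :=
  haveI : CompleteSpace S.toSubmodule := S.isClosed.completeSpace_coe
  S.toSubmodule.starProjection

/-- The operator `A = P_S - P_T`. -/
noncomputable def projDiff {H : Type*} [NormedAddCommGroup H] [InnerProductSpace ℂ H]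
    [CompleteSpace H] (S T : ClosedSubmodule ℂ H) : H →L[ℂ] H :=
  orthProj S - orthProj T

/-- The subspace `(N(A - 1) ⊕ N(A + 1))ᗮ`. -/
noncomputable def eigenCompl {H : Type*} [NormedAddCommGroup H] [InnerProductSpace ℂ H]
    (A : H →L[ℂ] H) : Submodule ℂ H :=
  ((A - 1).ker ⊔ (A + 1).ker)ᗮ

/-! Put M = S ∩ Tᗮ and N = Sᗮ ∩ T, the eigenspaces of A for 1 and -1. A cycle of implications gives
both equivalences: no common complement ⇒ dim M ≠ dim N and A is compact on (M ⊕ N)ᗮ ⇒ dim M ≠ dim N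
and one of the two products is compact ⇒ no common complement.

Existence. A² commutes with P_S and P_T, so its spectral subspaces reduce both. Choose such an L
containing M and N, on which A is bounded below and S ∩ L, T ∩ L have equal dimension. In L these
two are complementary, and the graph of an isomorphism between them complements both
(`hasCommonComplement_of_isCompl`). On Lᗮ nothing of M and N is left, and the negative spectral
subspace of P_S + P_T - 1 complements both (`isCompl_nonnegSpace_orthogonal`). If dim M = dim N,
take L = N(A² - 1). If A is not compact on (M ⊕ N)ᗮ, take L the spectral subspace of A² for some [δ,
∞), 0 < δ < 1, meeting (M ⊕ N)ᗮ in infinite dimension; then S ∩ L and T ∩ L are both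
infinite-dimensional, hence isomorphic by separability.

Obstruction. If dim M ≠ dim N, one of them is finite, say M. As P_S P_Tᗮ = P_S A vanishes on N,
compactness of A on (M ⊕ N)ᗮ makes this product compact. But then, if Z is a common complement,
projection along Z is an isomorphism S → T differing from P_T|S by a compact operator. So P_T|S has
index zero; its kernel is M and its cokernel N, whence dim M = dim N. -/

/-! ### Compact operators: Schauder's theorem and index zero of 1 - K. -/

section CompactOperators

open Module

variable {X Y : Type*} [NormedAddCommGroup X] [InnerProductSpace ℂ X]
  [NormedAddCommGroup Y] [InnerProductSpace ℂ Y]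

/-- The orthogonal projection of `x` onto `V` is at least as close to `x` as any point of `V`. -/
theorem norm_sub_starProjection_le_norm_sub (V : Submodule ℂ X) [V.HasOrthogonalProjection]
    (x : X) {v : X} (hv : v ∈ V) : ‖x - V.starProjection x‖ ≤ ‖x - v‖ := by
  rw [Submodule.starProjection_minimal]
  exact ciInf_le ⟨0, Set.forall_mem_range.mpr fun _ => norm_nonneg _⟩ (⟨v, hv⟩ : V)

/-- A bounded operator which factors through a finite-dimensional subspace is compact. -/
theorem isCompactOperator_comp_starProjection (V : Submodule ℂ X) [FiniteDimensional ℂ V]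
    (f : X →L[ℂ] Y) : IsCompactOperator (f ∘L V.starProjection) := by
  have : LocallyCompactSpace V := .of_finiteDimensional_of_complete ℂ V
  exact (isCompactOperator_of_locallyCompactSpace_dom V.orthogonalProjectionOnto).clm_comp
    (f ∘L V.subtypeL)

/-- A compact operator into a Hilbert space is approximated by its compressions to
finite-dimensional subspaces. -/
theorem IsCompactOperator.exists_finiteDimensional_norm_sub_le {K : X →L[ℂ] Y}
    (hK : IsCompactOperator K) {ε : ℝ} (hε : 0 < ε) :
    ∃ (V : Submodule ℂ Y) (_ : FiniteDimensional ℂ V), ‖K - V.starProjection ∘L K‖ ≤ ε := by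
  have htb : TotallyBounded (K '' Metric.closedBall 0 1) :=
    (hK.isCompact_closure_image_closedBall (f := (K : X →ₗ[ℂ] Y)) 1).totallyBounded.subset
      subset_closure
  obtain ⟨t, ht, hcover⟩ := Metric.totallyBounded_iff.1 htb ε hε
  have hfin : FiniteDimensional ℂ (Submodule.span ℂ t) := FiniteDimensional.span_of_finite ℂ ht
  refine ⟨Submodule.span ℂ t, hfin, ContinuousLinearMap.opNorm_le_of_unit_norm hε.le ?_⟩
  intro x hx
  obtain ⟨y, hy, hxy⟩ := Set.mem_iUnion₂.1
    (hcover (Set.mem_image_of_mem K (by simp [hx] : x ∈ Metric.closedBall (0 : X) 1)))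
  refine (norm_sub_starProjection_le_norm_sub _ (K x) (Submodule.subset_span hy)).trans ?_
  rw [← dist_eq_norm]
  exact (Metric.mem_ball.1 hxy).le

variable [CompleteSpace X] [CompleteSpace Y]

/-- **Schauder's theorem** for Hilbert spaces: the adjoint of a compact operator is compact. -/
theorem IsCompactOperator.adjoint {K : X →L[ℂ] Y} (hK : IsCompactOperator K) :
    IsCompactOperator (ContinuousLinearMap.adjoint K) := by
  have hcl := isClosed_setOfPred_isCompactOperator (σ₁₂ := RingHom.id ℂ) (M₁ := Y) (M₂ := X)
  refine hcl.closure_subset (Metric.mem_closure_iff.2 fun ε hε => ?_)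
  obtain ⟨V, hV, hle⟩ := hK.exists_finiteDimensional_norm_sub_le (half_pos hε)
  refine ⟨ContinuousLinearMap.adjoint K ∘L V.starProjection,
    isCompactOperator_comp_starProjection V _, ?_⟩
  have : ContinuousLinearMap.adjoint K ∘L V.starProjection
      = ContinuousLinearMap.adjoint (V.starProjection ∘L K) := by
    rw [ContinuousLinearMap.adjoint_comp, (isSelfAdjoint_starProjection V).adjoint_eq]
  rw [this, dist_eq_norm, ← map_sub, LinearIsometryEquiv.norm_map]
  linarith

/-- For compact `K`, the operator `1 - K` is surjective as soon as it is injective. -/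
theorem IsCompactOperator.surjective_one_sub {K : X →L[ℂ] X} (hK : IsCompactOperator K)
    (hinj : Function.Injective (1 - K : X →L[ℂ] X)) :
    Function.Surjective (1 - K : X →L[ℂ] X) := by
  rcases hK.hasEigenvalue_or_mem_resolventSet one_ne_zero with h | h
  · obtain ⟨v, hv⟩ := h.exists_hasEigenvector
    refine absurd (hinj ?_) hv.2
    have := hv.apply_eq_smul
    simp only [ContinuousLinearMap.coe_coe, one_smul] at this
    simp [this]
  · rw [spectrum.mem_resolventSet_iff, map_one, ContinuousLinearMap.isUnit_iff_bijective] at h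
    exact h.2

theorem IsCompactOperator.finiteDimensional_ker_one_sub {K : X →L[ℂ] X}
    (hK : IsCompactOperator K) : FiniteDimensional ℂ (1 - K).ker := by
  have := ContinuousLinearMap.finite_dimensional_eigenspace hK 1 one_ne_zero
  have heq : (1 - K).ker = End.eigenspace (K : X →ₗ[ℂ] X) 1 := by
    ext x
    simp [sub_eq_zero, eq_comm (a := x)]
  rwa [heq]

/-- Otherwise some injective φ embeds N = ker(1 - K) in ker(1 - K)*. The finite-rank perturbation (1
- K) + φ P_N has summands with orthogonal ranges, so it is injective, hence surjective; this forces
φ onto ker(1 - K)*, against the strict rank inequality. -/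
theorem IsCompactOperator.rank_ker_adjoint_one_sub_le {K : X →L[ℂ] X}
    (hK : IsCompactOperator K) :
    Module.rank ℂ (ContinuousLinearMap.adjoint (1 - K)).ker ≤ Module.rank ℂ (1 - K).ker := by
  set N := (1 - K).ker
  by_contra! hlt
  obtain ⟨φ, hφ⟩ := Module.Free.exists_linearMap_injective_of_rank_lt hlt
  have hfin : FiniteDimensional ℂ N := hK.finiteDimensional_ker_one_sub
  let ψ : N →L[ℂ] X := (ContinuousLinearMap.adjoint (1 - K)).ker.subtypeL ∘L
    LinearMap.toContinuousLinearMap φ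
  let G : X →L[ℂ] X := ψ ∘L N.orthogonalProjectionOnto
  have hψ : ∀ (n : N) (x : X), inner ℂ (ψ n) ((1 - K) x) = 0 := by
    intro n x
    rw [← ContinuousLinearMap.adjoint_inner_left]
    have : ContinuousLinearMap.adjoint (1 - K) (ψ n) = 0 := (φ n).2
    rw [this, inner_zero_left]
  have hG : IsCompactOperator G := by
    have : LocallyCompactSpace N := .of_finiteDimensional_of_complete ℂ N
    exact (isCompactOperator_of_locallyCompactSpace_dom N.orthogonalProjectionOnto).clm_comp ψ
  have key : ∀ x, (1 - (K - G)) x = (1 - K) x + ψ (N.orthogonalProjectionOnto x) := by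
    intro x
    simp [G]
    abel
  have split : ∀ (x : X) (n : N), (1 - K) x + ψ n = 0 → (1 - K) x = 0 ∧ ψ n = 0 := by
    intro x n h
    have h0 : ψ n = 0 := by
      have h1 := hψ n x
      rw [eq_neg_of_add_eq_zero_left h, inner_neg_right, neg_eq_zero] at h1
      exact inner_self_eq_zero.1 h1
    exact ⟨by simpa [h0] using h, h0⟩
  have hψinj : ∀ n, ψ n = 0 → n = 0 := fun n hn => hφ (by
    rw [map_zero]; exact Subtype.ext hn)
  have hinj : Function.Injective (1 - (K - G) : X →L[ℂ] X) := by
    refine (injective_iff_map_eq_zero _).2 fun x hx => ?_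
    rw [key] at hx
    obtain ⟨h1, h2⟩ := split _ _ hx
    have h3 := hψinj _ h2
    have hxN : x ∈ N := h1
    have := Submodule.orthogonalProjectionOnto_mem_subspace_eq_self (⟨x, hxN⟩ : N)
    rw [h3] at this
    exact (congrArg Subtype.val this).symm
  have hsurj := (hK.sub hG).surjective_one_sub (K := K - G) hinj
  have hφsurj : Function.Surjective φ := by
    intro y
    obtain ⟨x, hx⟩ := hsurj (y : X)
    rw [key] at hx
    refine ⟨N.orthogonalProjectionOnto x, Subtype.ext ?_⟩
    have horth : inner ℂ ((y : X) - ψ (N.orthogonalProjectionOnto x)) ((1 - K) x) = 0 := by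
      rw [inner_sub_left, hψ, ← ContinuousLinearMap.adjoint_inner_left]
      have : ContinuousLinearMap.adjoint (1 - K) (y : X) = 0 := y.2
      rw [this, inner_zero_left, sub_zero]
    have h1 : (1 - K) x = (y : X) - ψ (N.orthogonalProjectionOnto x) := by
      rw [← hx]; abel
    rw [h1, inner_self_eq_zero, sub_eq_zero] at horth
    exact horth.symm
  exact (not_le.2 hlt) (LinearMap.rank_le_of_surjective φ hφsurj)

/-- `1 - K` has index zero for compact `K`. -/
theorem IsCompactOperator.rank_ker_one_sub_eq {K : X →L[ℂ] X} (hK : IsCompactOperator K) :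
    Module.rank ℂ (1 - K).ker = Module.rank ℂ (ContinuousLinearMap.adjoint (1 - K)).ker := by
  refine le_antisymm ?_ hK.rank_ker_adjoint_one_sub_le
  have h := hK.adjoint.rank_ker_adjoint_one_sub_le
  have h1 : ContinuousLinearMap.adjoint (1 - K) = 1 - ContinuousLinearMap.adjoint K := by
    rw [map_sub, ← ContinuousLinearMap.star_eq_adjoint, star_one]
  rwa [← h1, ContinuousLinearMap.adjoint_adjoint] at h

end CompactOperators

universe u

/-! ### Index zero for compact perturbations of an isomorphism. -/

section IndexZero

variable {X Y : Type u} [NormedAddCommGroup X] [InnerProductSpace ℂ X]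
  [NormedAddCommGroup Y] [InnerProductSpace ℂ Y] [CompleteSpace X] [CompleteSpace Y]

/-- (eF)* = F* e* and e* is injective, so e* embeds one kernel in the other. Using it for e and for
its inverse gives equality of ranks. -/
theorem rank_ker_adjoint_le_of_comp {Z : Type u} [NormedAddCommGroup Z] [InnerProductSpace ℂ Z]
    [CompleteSpace Z] (e : Y ≃L[ℂ] Z) (F : X →L[ℂ] Y) :
    Module.rank ℂ (ContinuousLinearMap.adjoint ((e : Y →L[ℂ] Z) ∘L F)).ker
      ≤ Module.rank ℂ (ContinuousLinearMap.adjoint F).ker := by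
  have hinj : Function.Injective (ContinuousLinearMap.adjoint (e : Y →L[ℂ] Z)) := by
    refine (injective_iff_map_eq_zero _).2 fun z hz => ?_
    rw [← inner_self_eq_zero (𝕜 := ℂ)]
    nth_rw 2 [← e.apply_symm_apply z]
    rw [← ContinuousLinearEquiv.coe_coe, ← ContinuousLinearMap.adjoint_inner_left, hz,
      inner_zero_left]
  let g := ((ContinuousLinearMap.adjoint (e : Y →L[ℂ] Z)) : Z →ₗ[ℂ] Y).restrict
    (p := (ContinuousLinearMap.adjoint ((e : Y →L[ℂ] Z) ∘L F)).ker)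
    (q := (ContinuousLinearMap.adjoint F).ker) (fun z hz => by
      rw [ContinuousLinearMap.adjoint_comp] at hz
      exact hz)
  refine LinearMap.rank_le_of_injective g fun a b hab => Subtype.ext (hinj ?_)
  exact congrArg Subtype.val hab

/-- A compact perturbation of an isomorphism has index zero. -/
theorem IsCompactOperator.rank_ker_equiv_sub_eq (e : X ≃L[ℂ] Y) {K : X →L[ℂ] Y}
    (hK : IsCompactOperator K) :
    Module.rank ℂ ((e : X →L[ℂ] Y) - K).ker
      = Module.rank ℂ ((e : X →L[ℂ] Y) - K).rangeᗮ := by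
  have hK' : IsCompactOperator ((e.symm : Y →L[ℂ] X) ∘L K) := hK.clm_comp (e.symm : Y →L[ℂ] X)
  have hC : (e : X →L[ℂ] Y) ∘L (1 - (e.symm : Y →L[ℂ] X) ∘L K) = (e : X →L[ℂ] Y) - K := by
    ext x; simp
  have hF : (e.symm : Y →L[ℂ] X) ∘L ((e : X →L[ℂ] Y) - K) = 1 - (e.symm : Y →L[ℂ] X) ∘L K := by
    ext x; simp
  have hker : ((e : X →L[ℂ] Y) - K).ker = (1 - (e.symm : Y →L[ℂ] X) ∘L K).ker := by
    ext x
    simp [sub_eq_zero, e.eq_symm_apply]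
  rw [ContinuousLinearMap.orthogonal_range, hker, hK'.rank_ker_one_sub_eq]
  apply le_antisymm
  · rw [← hF]
    exact rank_ker_adjoint_le_of_comp e.symm _
  · have := rank_ker_adjoint_le_of_comp e (1 - (e.symm : Y →L[ℂ] X) ∘L K)
    rwa [hC] at this

end IndexZero

/-! ### Dimension in separable Hilbert spaces. -/

section SeparableHilbert

open Module

/-- An orthonormal family in a separable space is countable. -/
theorem Orthonormal.countable_of_separableSpace {X ι : Type*} [NormedAddCommGroup X]
    [InnerProductSpace ℂ X] [TopologicalSpace.SeparableSpace X] {v : ι → X}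
    (hv : Orthonormal ℂ v) : Countable ι := by
  refine Pairwise.countable_of_isOpen_disjoint (s := fun i => Metric.ball (v i) (1 / 2)) ?_
    (fun i => Metric.isOpen_ball) (fun i => ⟨v i, Metric.mem_ball_self (by norm_num)⟩)
  intro i j hij
  apply Metric.ball_disjoint_ball
  have h : ‖v i - v j‖ ^ 2 = 2 := by
    rw [@norm_sub_sq ℂ, hv.1, hv.1, hv.2 hij]
    norm_num
  rw [dist_eq_norm]
  nlinarith [norm_nonneg (v i - v j)]

/-- An infinite-dimensional separable Hilbert space has a Hilbert basis indexed by `ℕ`. -/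
theorem exists_hilbertBasis_nat (X : Type*) [NormedAddCommGroup X] [InnerProductSpace ℂ X]
    [CompleteSpace X] [TopologicalSpace.SeparableSpace X] (h : ¬ FiniteDimensional ℂ X) :
    Nonempty (HilbertBasis ℕ ℂ X) := by
  obtain ⟨w, b, -⟩ := exists_hilbertBasis ℂ X
  have : Countable w := b.orthonormal.countable_of_separableSpace
  have : Infinite w := by
    by_contra hfin
    rw [not_infinite_iff_finite] at hfin
    have := Fintype.ofFinite w
    exact h (Module.Finite.of_basis b.toOrthonormalBasis.toBasis)
  obtain ⟨e⟩ : Nonempty (ℕ ≃ w) := nonempty_equiv_of_countable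
  refine ⟨HilbertBasis.mk (v := b ∘ e) (b.orthonormal.comp e e.injective) ?_⟩
  rw [Set.range_comp, e.surjective.range_eq, Set.image_univ]
  exact b.dense_span.ge

/-- `Cardinal.toENat` sends every infinite cardinal to `⊤`, so it does not matter that the algebraic
rank exceeds the Hilbert dimension. -/
theorem hdim_eq_top_iff {H : Type*} [NormedAddCommGroup H] [InnerProductSpace ℂ H]
    (V : Submodule ℂ H) : hdim V = ⊤ ↔ ¬ FiniteDimensional ℂ V := by
  rw [hdim, Cardinal.toENat_eq_top, ← not_lt, Module.rank_lt_aleph0_iff]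

/-- Closed subspaces of equal dimension in a separable Hilbert space are isomorphic. -/
theorem nonempty_continuousLinearEquiv_of_hdim_eq {H : Type*} [NormedAddCommGroup H]
    [InnerProductSpace ℂ H] [TopologicalSpace.SeparableSpace H] (V W : Submodule ℂ H)
    [CompleteSpace V] [CompleteSpace W] (h : hdim V = hdim W) : Nonempty (V ≃L[ℂ] W) := by
  have : SecondCountableTopology H := UniformSpace.secondCountable_of_separable H
  by_cases hV : FiniteDimensional ℂ V
  · have hW : FiniteDimensional ℂ W := by
      by_contra hW
      rw [(hdim_eq_top_iff W).2 hW, hdim_eq_top_iff] at h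
      exact h hV
    refine ⟨ContinuousLinearEquiv.ofFinrankEq ?_⟩
    rw [hdim, hdim, ← finrank_eq_rank, ← finrank_eq_rank] at h
    simpa only [map_natCast, Nat.cast_inj] using h
  · have hW : ¬ FiniteDimensional ℂ W := by
      rwa [← hdim_eq_top_iff, ← h, hdim_eq_top_iff]
    obtain ⟨b⟩ := exists_hilbertBasis_nat V hV
    obtain ⟨c⟩ := exists_hilbertBasis_nat W hW
    exact ⟨(b.repr.trans c.repr.symm).toContinuousLinearEquiv⟩

end SeparableHilbert

/-! ### Self-adjoint operators: lower bounds and invariant subspaces. -/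

section BoundedBelow

variable {X : Type*} [NormedAddCommGroup X] [InnerProductSpace ℂ X] [CompleteSpace X]

/-- A self-adjoint operator which is bounded below is surjective. -/
theorem IsSelfAdjoint.surjective_of_bounded_below {E : X →L[ℂ] X} (hE : IsSelfAdjoint E) {c : ℝ}
    (hc : 0 < c) (h : ∀ x, c * ‖x‖ ≤ ‖E x‖) : Function.Surjective E := by
  -- ⟨E²x, x⟩ = ‖Ex‖² ≥ c²‖x‖² makes E² coercive, hence invertible, and the range of E contains that
  -- of E².
  have hunit : IsUnit (E * E) := by
    refine ContinuousLinearMap.isUnit_of_forall_le_norm_inner_map (E * E)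
      (c := ⟨c ^ 2, by positivity⟩) (by exact_mod_cast pow_pos hc 2) fun x => ?_
    have h1 : inner ℂ ((E * E) x) x = inner ℂ (E x) (E x) := hE.isSymmetric (E x) x
    rw [h1, inner_self_eq_norm_sq_to_K, norm_pow, RCLike.norm_ofReal, abs_norm]
    have h2 := pow_le_pow_left₀ (by positivity) (h x) 2
    rw [mul_pow, mul_comm] at h2
    exact h2
  intro y
  obtain ⟨x, hx⟩ := (ContinuousLinearMap.isUnit_iff_bijective.1 hunit).2 y
  exact ⟨E x, hx⟩

/-- If `P_S - P_Z` is bounded below, then `S` and `Z` are complementary. -/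
theorem isCompl_of_starProjection_sub_bounded_below (S Z : Submodule ℂ X)
    [S.HasOrthogonalProjection] [Z.HasOrthogonalProjection] {c : ℝ} (hc : 0 < c)
    (h : ∀ x, c * ‖x‖ ≤ ‖S.starProjection x - Z.starProjection x‖) : IsCompl S Z := by
  constructor
  · rw [Submodule.disjoint_def]
    intro x hS hZ
    have := h x
    rw [Submodule.starProjection_eq_self_iff.2 hS, Submodule.starProjection_eq_self_iff.2 hZ,
      sub_self, norm_zero] at this
    exact norm_le_zero_iff.1 (nonpos_of_mul_nonpos_right this hc)
  · rw [codisjoint_iff, eq_top_iff]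
    intro x _
    obtain ⟨y, rfl⟩ := ((isSelfAdjoint_starProjection S).sub
      (isSelfAdjoint_starProjection Z)).surjective_of_bounded_below hc h x
    exact Submodule.sub_mem_sup (Submodule.starProjection_apply_mem S y)
      (Submodule.starProjection_apply_mem Z y)

/-- The projection onto an invariant subspace of a self-adjoint operator commutes with it. -/
theorem IsSelfAdjoint.commute_starProjection_of_invariant {C : X →L[ℂ] X} (hC : IsSelfAdjoint C)
    (V : Submodule ℂ X) [V.HasOrthogonalProjection] (h : ∀ x ∈ V, C x ∈ V) :
    Commute V.starProjection C := by
  ext x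
  simp only [mul_apply_eq_comp]
  refine (Submodule.eq_starProjection_of_mem_orthogonal
    (h _ (Submodule.starProjection_apply_mem V x)) ?_)
  rw [← map_sub, Submodule.mem_orthogonal]
  intro v hv
  rw [← ContinuousLinearMap.adjoint_inner_left, hC.adjoint_eq]
  exact Submodule.inner_right_of_mem_orthogonal (h v hv)
    (Submodule.sub_starProjection_mem_orthogonal x)

end BoundedBelow

/-! ### Nonnegative spectral subspaces via positive and negative parts. -/

section NonnegSpace

variable {X : Type*} [NormedAddCommGroup X] [InnerProductSpace ℂ X]

theorem re_inner_nonneg_of_nonneg {D : X →L[ℂ] X} (hD : 0 ≤ D) (x : X) :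
    0 ≤ RCLike.re (inner ℂ (D x) x) :=
  ((ContinuousLinearMap.nonneg_iff_isPositive D).1 hD).re_inner_nonneg_left x

variable [CompleteSpace X]

/-- The kernel of the negative part of a self-adjoint operator, that is, its spectral subspace for
the interval `[0, ∞)`. -/
noncomputable def nonnegSpace (D : X →L[ℂ] X) : Submodule ℂ X := (D⁻).ker

theorem isClosed_nonnegSpace (D : X →L[ℂ] X) : IsClosed (nonnegSpace D : Set X) :=
  ContinuousLinearMap.isClosed_ker D⁻

instance (D : X →L[ℂ] X) : CompleteSpace (nonnegSpace D) :=
  (isClosed_nonnegSpace D).completeSpace_coe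

theorem posPart_apply_mem_nonnegSpace (D : X →L[ℂ] X) (x : X) : D⁺ x ∈ nonnegSpace D := by
  have := congrArg (fun f : X →L[ℂ] X => f x) (CFC.negPart_mul_posPart D)
  exact this

theorem negPart_apply_of_mem_nonnegSpace {D : X →L[ℂ] X} {x : X} (hx : x ∈ nonnegSpace D) :
    D⁻ x = 0 := hx

theorem isSelfAdjoint_posPart (D : X →L[ℂ] X) : IsSelfAdjoint D⁺ :=
  .of_nonneg (CFC.posPart_nonneg D)

/-- ‖D⁺x‖² = ⟨D⁺D⁺x, x⟩, and the range of D⁺ lies in `nonnegSpace D`. -/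
theorem posPart_apply_of_mem_nonnegSpace_orthogonal {D : X →L[ℂ] X} {x : X}
    (hx : x ∈ (nonnegSpace D)ᗮ) : D⁺ x = 0 := by
  rw [← inner_self_eq_zero (𝕜 := ℂ)]
  have h := (isSelfAdjoint_posPart D).isSymmetric (D⁺ x) x
  exact h ▸ Submodule.inner_right_of_mem_orthogonal (posPart_apply_mem_nonnegSpace D (D⁺ x)) hx

theorem apply_eq_posPart_sub_negPart {D : X →L[ℂ] X} (hD : IsSelfAdjoint D) (x : X) :
    D x = D⁺ x - D⁻ x := by
  conv_lhs => rw [← CFC.posPart_sub_negPart D hD]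
  rfl

theorem re_inner_nonneg_of_mem_nonnegSpace {D : X →L[ℂ] X} (hD : IsSelfAdjoint D) {x : X}
    (hx : x ∈ nonnegSpace D) : 0 ≤ RCLike.re (inner ℂ (D x) x) := by
  rw [apply_eq_posPart_sub_negPart hD, negPart_apply_of_mem_nonnegSpace hx, sub_zero]
  exact re_inner_nonneg_of_nonneg (CFC.posPart_nonneg D) x

theorem re_inner_nonpos_of_mem_nonnegSpace_orthogonal {D : X →L[ℂ] X} (hD : IsSelfAdjoint D)
    {x : X} (hx : x ∈ (nonnegSpace D)ᗮ) : RCLike.re (inner ℂ (D x) x) ≤ 0 := by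
  rw [apply_eq_posPart_sub_negPart hD, posPart_apply_of_mem_nonnegSpace_orthogonal hx, zero_sub,
    inner_neg_left, map_neg, neg_nonpos]
  exact re_inner_nonneg_of_nonneg (CFC.negPart_nonneg D) x

/-- Eigenvectors for positive eigenvalues belong to the nonnegative spectral subspace. -/
theorem mem_nonnegSpace_of_apply_eq_smul {D : X →L[ℂ] X} (hD : IsSelfAdjoint D) {x : X} {r : ℝ}
    (hr : 0 < r) (hx : D x = (r : ℂ) • x) : x ∈ nonnegSpace D := by
  -- With Dx = rx this reads D⁻D⁻x = -r D⁻x; pairing with D⁻x and using D⁻ ≥ 0 gives -r‖D⁻x‖² ≥ 0.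
  have h1 : D⁻ (D x) = - D⁻ (D⁻ x) := by
    rw [apply_eq_posPart_sub_negPart hD, map_sub,
      negPart_apply_of_mem_nonnegSpace (posPart_apply_mem_nonnegSpace D x), zero_sub]
  rw [hx, map_smul] at h1
  have h2 := re_inner_nonneg_of_nonneg (CFC.negPart_nonneg D) (D⁻ x)
  rw [← neg_eq_iff_eq_neg] at h1
  rw [← h1, inner_neg_left, inner_smul_left, Complex.conj_ofReal, map_neg, ← Complex.coe_algebraMap,
    RCLike.re_ofReal_mul, inner_self_eq_norm_sq] at h2
  have h3 : ‖D⁻ x‖ ^ 2 ≤ 0 := by nlinarith [sq_nonneg ‖D⁻ x‖]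
  exact norm_eq_zero.1 (pow_eq_zero_iff two_ne_zero |>.1 (le_antisymm h3 (sq_nonneg _)))

/-- D⁻ is a function of D, so C commutes with it and preserves its kernel. -/
theorem IsSelfAdjoint.commute_starProjection_nonnegSpace {C D : X →L[ℂ] X} (hC : IsSelfAdjoint C)
    (h : Commute D C) : Commute (nonnegSpace D).starProjection C := by
  refine hC.commute_starProjection_of_invariant _ fun x hx => ?_
  have hcomm : Commute D⁻ C := h.cfcₙ_real _
  have := congrArg (fun f : X →L[ℂ] X => f x) hcomm.eq
  simp only [mul_apply_eq_comp, negPart_apply_of_mem_nonnegSpace hx, map_zero] at this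
  exact this

/-- The polar decomposition of a self-adjoint operator, with the reflection in `nonnegSpace D` as
its unitary part. -/
theorem reflection_mul_abs {D : X →L[ℂ] X} (hD : IsSelfAdjoint D) :
    (2 * (nonnegSpace D).starProjection - 1) * CFC.abs D = D := by
  have hneg : ∀ x, D⁻ x ∈ (nonnegSpace D)ᗮ := fun x => by
    rw [Submodule.mem_orthogonal]
    intro u hu
    have h : IsSelfAdjoint D⁻ := .of_nonneg (CFC.negPart_nonneg D)
    rw [← h.isSymmetric.apply_clm u x, negPart_apply_of_mem_nonnegSpace hu, inner_zero_left]
  ext x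
  rw [← CFC.posPart_add_negPart D hD, apply_eq_posPart_sub_negPart hD]
  have h1 := Submodule.starProjection_eq_self_iff.2 (posPart_apply_mem_nonnegSpace D x)
  have h2 := (Submodule.starProjection_apply_eq_zero_iff _).2 (hneg x)
  simp [two_mul, h1, h2]

theorem abs_mul_reflection {D : X →L[ℂ] X} (hD : IsSelfAdjoint D) :
    CFC.abs D * (2 * (nonnegSpace D).starProjection - 1) = D := by
  have h := congrArg star (reflection_mul_abs hD)
  have h1 : star (CFC.abs D) = CFC.abs D := IsSelfAdjoint.of_nonneg (CFC.abs_nonneg D)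
  have h2 : star (nonnegSpace D).starProjection = (nonnegSpace D).starProjection :=
    isSelfAdjoint_starProjection _
  simpa [h1, h2, hD.star_eq, mul_two, two_mul] using h

end NonnegSpace

/-! ### Common complements in the two basic positions. -/

section CommonComplement

variable {X : Type*} [NormedAddCommGroup X] [InnerProductSpace ℂ X]

theorem HasCommonComplement.symm {S T : Submodule ℂ X} (h : HasCommonComplement S T) :
    HasCommonComplement T S :=
  let ⟨Z, hZ, hS, hT⟩ := h
  ⟨Z, hZ, hT, hS⟩

/-- Both products equal P_S P_T P_S. -/
theorem commute_starProjection_add_sub_one_sq (S T : Submodule ℂ X)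
    [S.HasOrthogonalProjection] [T.HasOrthogonalProjection] :
    Commute S.starProjection ((S.starProjection + T.starProjection - 1) *
      (S.starProjection + T.starProjection - 1)) := by
  have hP : S.starProjection * S.starProjection = S.starProjection :=
    S.isIdempotentElem_starProjection
  have hQ : T.starProjection * T.starProjection = T.starProjection :=
    T.isIdempotentElem_starProjection
  generalize S.starProjection = P at *
  generalize T.starProjection = Q at *
  have hP' : ∀ Y, P * (P * Y) = P * Y := fun Y => by rw [← mul_assoc, hP]
  rw [commute_iff_eq]
  simp only [mul_add, add_mul, mul_sub, sub_mul, mul_one, one_mul, hP, hP', hQ, mul_assoc]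
  abel

variable [CompleteSpace X]

/-- When `P_S + P_T - 1` is injective, `S` is complementary to the negative spectral subspace of
this operator. -/
theorem isCompl_nonnegSpace_orthogonal (S T : Submodule ℂ X)
    [S.HasOrthogonalProjection] [T.HasOrthogonalProjection]
    (hinj : ∀ x, S.starProjection x + T.starProjection x = x → x = 0) :
    IsCompl S (nonnegSpace (S.starProjection + T.starProjection - 1))ᗮ := by
  set B := S.starProjection + T.starProjection - 1 with hB
  have hBsa : IsSelfAdjoint B := ((isSelfAdjoint_starProjection S).add
    (isSelfAdjoint_starProjection T)).sub (.one _)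
  set m := CFC.abs B with hm
  set V := nonnegSpace B
  have hmm : m * m = B * B := by rw [hm, CFC.abs_mul_abs, hBsa.star_eq]
  have hminj : ∀ x, m x = 0 → x = 0 := by
    intro x hx
    apply hinj
    have h1 : B x = 0 := by
      rw [← reflection_mul_abs hBsa, mul_apply_eq_comp]
      change (2 * V.starProjection - 1 : X →L[ℂ] X) (m x) = 0
      rw [hx, map_zero]
    rwa [hB, sub_apply, add_apply, one_apply_eq_self, sub_eq_zero] at h1
  have hcomm : Commute S.starProjection m := by
    have h := (commute_starProjection_add_sub_one_sq S T).symm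
    rw [← hB, ← hmm] at h
    have h2 : CFC.sqrt (m * m) = m := CFC.sqrt_mul_self m (CFC.abs_nonneg B)
    rw [← h2]
    exact (h.cfcₙ_nnreal _).symm
  have hP : S.starProjection * S.starProjection = S.starProjection :=
    S.isIdempotentElem_starProjection
  have hQ : T.starProjection * T.starProjection = T.starProjection :=
    T.isIdempotentElem_starProjection
  have hV : V.starProjection * V.starProjection = V.starProjection :=
    V.isIdempotentElem_starProjection
  have hJm := reflection_mul_abs hBsa
  have hmJ := abs_mul_reflection hBsa
  -- R and J are symmetries, with J the sign of B and m = |B|. From RB + BR = 2B² and Rm = mR,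
  -- cancelling the injective m yields RJ + JR = 2m, so (R + J)² = 2 + 2m ≥ 2.
  set R := 2 * S.starProjection - 1 with hR
  set J := 2 * V.starProjection - 1 with hJ
  have hRm : m * R = R * m := by
    rw [hR, mul_sub, sub_mul, two_mul, mul_add, add_mul, hcomm.eq, mul_one, one_mul]
  have hRB : R * B + B * R = 2 * (B * B) := by
    rw [hR, hB, two_mul (_ * _)]
    simp only [mul_add, add_mul, mul_sub, sub_mul, mul_one, one_mul, hP, hQ, two_mul]
    abel
  have hRJ : R * J + J * R = 2 * m := by
    have h : m * (R * J + J * R) = m * (2 * m) := by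
      rw [mul_add, ← mul_assoc, hRm, mul_assoc, hmJ, ← mul_assoc, hmJ, hRB, two_mul m, mul_add,
        hmm, two_mul]
    ext x
    rw [← sub_eq_zero]
    apply hminj
    have := congrArg (fun f : X →L[ℂ] X => f x) h
    rw [map_sub, sub_eq_zero]
    exact this
  have hRR : R * R = 1 := by
    rw [hR]
    simp only [mul_sub, sub_mul, mul_one, one_mul, hP, two_mul, mul_add, add_mul]
    abel
  have hJJ : J * J = 1 := by
    rw [hJ]
    simp only [mul_sub, sub_mul, mul_one, one_mul, hV, two_mul, mul_add, add_mul]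
    abel
  have hsq : (R + J) * (R + J) = 2 + 2 * m := by
    rw [← hRJ, mul_add, add_mul, add_mul, hRR, hJJ, ← one_add_one_eq_two]
    abel
  have hsa : IsSelfAdjoint (R + J) := by
    refine .add ?_ ?_
    · exact (two_mul S.starProjection ▸ (isSelfAdjoint_starProjection S).add
        (isSelfAdjoint_starProjection S)).sub (.one _)
    · exact (two_mul V.starProjection ▸ (isSelfAdjoint_starProjection V).add
        (isSelfAdjoint_starProjection V)).sub (.one _)
  -- R + J = 2(P_S - P_Vᗮ), so the lower bound is in fact 1/√2; 1/2 suffices.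
  refine isCompl_of_starProjection_sub_bounded_below S Vᗮ (c := 1 / 2) (by norm_num) fun x => ?_
  have hx : (R + J) x = (2 : ℂ) • (S.starProjection x - Vᗮ.starProjection x) := by
    rw [Submodule.starProjection_orthogonal', hR, hJ]
    simp [two_mul, two_smul]
    abel
  have hnorm : ‖(R + J) x‖ ^ 2 = 2 * ‖x‖ ^ 2 + 2 * RCLike.re (inner ℂ (m x) x) := by
    have h1 : inner ℂ ((R + J) x) ((R + J) x) = inner ℂ (((R + J) * (R + J)) x) x :=
      (hsa.isSymmetric ((R + J) x) x).symm
    rw [← inner_self_eq_norm_sq (𝕜 := ℂ), h1, hsq, ← inner_self_eq_norm_sq (𝕜 := ℂ) x, two_mul m,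
      ← one_add_one_eq_two]
    simp only [add_apply, one_apply_eq_self, inner_add_left, map_add]
    ring
  have hpos := re_inner_nonneg_of_nonneg (CFC.abs_nonneg B) x
  rw [hx, norm_smul, Complex.norm_ofNat, mul_pow] at hnorm
  refine le_of_sq_le_sq ?_ (norm_nonneg _)
  rw [mul_pow]
  nlinarith [sq_nonneg ‖x‖]

/-- Closed subspaces `S` and `T` with `S ∩ Tᗮ = 0` and `Sᗮ ∩ T = 0` have a common complement. -/
theorem hasCommonComplement_of_inf_orthogonal_eq_bot (S T : Submodule ℂ X)
    [S.HasOrthogonalProjection] [T.HasOrthogonalProjection]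
    (h₁ : S ⊓ Tᗮ = ⊥) (h₂ : Sᗮ ⊓ T = ⊥) : HasCommonComplement S T := by
  have hinj : ∀ x, S.starProjection x + T.starProjection x = x → x = 0 := by
    intro x hx
    have hS : S.starProjection x = 0 := by
      rw [← Submodule.mem_bot ℂ, ← h₁]
      refine ⟨Submodule.starProjection_apply_mem S x, ?_⟩
      rw [← eq_sub_iff_add_eq] at hx
      exact hx ▸ Submodule.sub_starProjection_mem_orthogonal x
    have hT : T.starProjection x = 0 := by
      rw [← Submodule.mem_bot ℂ, ← h₂]
      refine ⟨?_, Submodule.starProjection_apply_mem T x⟩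
      rw [← eq_sub_iff_add_eq'] at hx
      exact hx ▸ Submodule.sub_starProjection_mem_orthogonal x
    rw [← hx, hS, hT, add_zero]
  -- P_S + P_T - 1 is symmetric in S and T, so the same subspace complements T.
  refine ⟨_, Submodule.isClosed_orthogonal _, isCompl_nonnegSpace_orthogonal S T hinj, ?_⟩
  rw [add_comm]
  exact isCompl_nonnegSpace_orthogonal T S fun x hx => hinj x (by rwa [add_comm])

/-- Complementary closed subspaces of equal dimension have a common complement: the graph of an
isomorphism between them. -/
theorem hasCommonComplement_of_isCompl [TopologicalSpace.SeparableSpace X] (S T : Submodule ℂ X)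
    (hS : IsClosed (S : Set X)) (hT : IsClosed (T : Set X)) (h : IsCompl S T)
    (hdim_eq : hdim S = hdim T) : HasCommonComplement S T := by
  have := hS.completeSpace_coe
  have := hT.completeSpace_coe
  obtain ⟨e⟩ := nonempty_continuousLinearEquiv_of_hdim_eq S T hdim_eq
  have hST := Submodule.IsCompl.isTopCompl_of_isClosed h hS hT
  let p := S.projectionOntoL T hST
  let q := T.projectionOntoL S hST.symm
  have hpS : ∀ s : S, p s = s := fun s => Submodule.projectionOntoL_apply_left hST s
  have hqT : ∀ t : T, q t = t := fun t => Submodule.projectionOntoL_apply_left hST.symm t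
  have hpT : ∀ t : T, p t = 0 := fun t => Submodule.projectionOntoL_apply_right hST t
  have hqS : ∀ s : S, q s = 0 := fun s => Submodule.projectionOntoL_apply_right hST.symm s
  -- `g` maps S onto T by -e and is the identity on T; its kernel is complementary to any subspace
  -- that it maps isomorphically onto T.
  let g : X →L[ℂ] T := q - (e : S →L[ℂ] T) ∘L p
  have hgS : ∀ s : S, g s = - e s := fun s => by simp [g, hpS, hqS]
  have hgT : ∀ t : T, g t = t := fun t => by simp [g, hpT, hqT]
  refine ⟨g.ker, ContinuousLinearMap.isClosed_ker g, ⟨?_, ?_⟩, ⟨?_, ?_⟩⟩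
  · rw [Submodule.disjoint_def]
    intro x hx hz
    have h1 : - e ⟨x, hx⟩ = 0 := (hgS ⟨x, hx⟩).symm.trans hz
    simpa using h1
  · rw [codisjoint_iff, eq_top_iff]
    intro x _
    refine Submodule.mem_sup.2 ⟨-(e.symm (g x) : S), neg_mem (e.symm (g x)).2,
      x + e.symm (g x), ?_, by abel⟩
    simp only [LinearMap.mem_ker, ContinuousLinearMap.coe_coe, map_add, hgS]
    simp
  · rw [Submodule.disjoint_def]
    intro x hx hz
    have h1 : (⟨x, hx⟩ : T) = 0 := (hgT ⟨x, hx⟩).symm.trans hz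
    exact congrArg Subtype.val h1
  · rw [codisjoint_iff, eq_top_iff]
    intro x _
    refine Submodule.mem_sup.2 ⟨g x, (g x).2, x - g x, ?_, by abel⟩
    simp only [LinearMap.mem_ker, ContinuousLinearMap.coe_coe, map_sub, hgT, sub_self]

end CommonComplement

/-! ### Gluing complements along L ⊕ Lᗮ. -/

section Gluing

variable {X : Type*} [NormedAddCommGroup X] [InnerProductSpace ℂ X]

/-- Invariance under P_L splits S into S ∩ L and S ∩ Lᗮ, so both conditions can be checked
componentwise. -/
theorem isCompl_of_isCompl_comap (L S : Submodule ℂ X) [L.HasOrthogonalProjection]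
    (hS : ∀ x ∈ S, L.starProjection x ∈ S) {Z₁ : Submodule ℂ L} {Z₂ : Submodule ℂ Lᗮ}
    (h₁ : IsCompl (S.comap L.subtype) Z₁) (h₂ : IsCompl (S.comap Lᗮ.subtype) Z₂) :
    IsCompl S (Z₁.comap (L.orthogonalProjectionOnto : X →ₗ[ℂ] L) ⊓
      Z₂.comap (Lᗮ.orthogonalProjectionOnto : X →ₗ[ℂ] Lᗮ)) := by
  constructor
  · rw [Submodule.disjoint_def]
    rintro x hx ⟨hz₁, hz₂⟩
    have e₁ : L.orthogonalProjectionOnto x = 0 :=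
      Submodule.disjoint_def.1 h₁.disjoint _ (hS x hx) hz₁
    have hx₂ : Lᗮ.starProjection x ∈ S := by
      rw [Submodule.starProjection_orthogonal_val]
      exact sub_mem hx (hS x hx)
    have e₂ : Lᗮ.orthogonalProjectionOnto x = 0 :=
      Submodule.disjoint_def.1 h₂.disjoint _ hx₂ hz₂
    rw [← Submodule.starProjection_add_starProjection_orthogonal (K := L) x,
      Submodule.starProjection_apply, Submodule.starProjection_apply, e₁, e₂]
    simp
  · rw [codisjoint_iff, eq_top_iff]
    intro x _
    obtain ⟨s₁, hs₁, z₁, hz₁, e₁⟩ := Submodule.mem_sup.1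
      (h₁.sup_eq_top ▸ Submodule.mem_top : L.orthogonalProjectionOnto x ∈ S.comap L.subtype ⊔ Z₁)
    obtain ⟨s₂, hs₂, z₂, hz₂, e₂⟩ := Submodule.mem_sup.1
      (h₂.sup_eq_top ▸ Submodule.mem_top :
        Lᗮ.orthogonalProjectionOnto x ∈ S.comap Lᗮ.subtype ⊔ Z₂)
    refine Submodule.mem_sup.2 ⟨s₁ + s₂, add_mem hs₁ hs₂, z₁ + z₂, ⟨?_, ?_⟩, ?_⟩
    · have : L.orthogonalProjectionOnto (z₂ : X) = 0 :=
        Submodule.orthogonalProjectionOnto_eq_zero_iff.2 z₂.2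
      simpa [this] using hz₁
    · have : Lᗮ.orthogonalProjectionOnto (z₁ : X) = 0 :=
        Submodule.orthogonalProjectionOnto_eq_zero_iff.2
          (Submodule.le_orthogonal_orthogonal L z₁.2)
      simpa [this] using hz₂
    · conv_rhs => rw [← Submodule.starProjection_add_starProjection_orthogonal (K := L) x,
        Submodule.starProjection_apply, Submodule.starProjection_apply, ← e₁, ← e₂]
      push_cast
      abel

/-- Common complements in a reducing subspace and in its orthogonal complement add up. -/
theorem hasCommonComplement_of_comap (L S T : Submodule ℂ X) [L.HasOrthogonalProjection]
    (hS : ∀ x ∈ S, L.starProjection x ∈ S) (hT : ∀ x ∈ T, L.starProjection x ∈ T)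
    (h₁ : HasCommonComplement (S.comap L.subtype) (T.comap L.subtype))
    (h₂ : HasCommonComplement (S.comap Lᗮ.subtype) (T.comap Lᗮ.subtype)) :
    HasCommonComplement S T := by
  obtain ⟨Z₁, hc₁, hS₁, hT₁⟩ := h₁
  obtain ⟨Z₂, hc₂, hS₂, hT₂⟩ := h₂
  exact ⟨_, (hc₁.preimage L.orthogonalProjectionOnto.continuous).inter
      (hc₂.preimage Lᗮ.orthogonalProjectionOnto.continuous),
    isCompl_of_isCompl_comap L S hS hS₁ hS₂, isCompl_of_isCompl_comap L T hT hT₁ hT₂⟩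

end Gluing

/-! ### Restriction to a reducing subspace. -/

section Reducing

variable {X : Type*} [NormedAddCommGroup X] [InnerProductSpace ℂ X]

theorem starProjection_mem_of_commute {L S : Submodule ℂ X} [L.HasOrthogonalProjection]
    [S.HasOrthogonalProjection] (h : Commute L.starProjection S.starProjection) {x : X}
    (hx : x ∈ S) : L.starProjection x ∈ S := by
  have h1 := congrArg (fun f : X →L[ℂ] X => f x) h.eq
  simp only [mul_apply_eq_comp, Submodule.starProjection_eq_self_iff.2 hx] at h1
  rw [h1]
  exact Submodule.starProjection_apply_mem S _

theorem hdim_comap_subtype (L S : Submodule ℂ X) : hdim (S.comap L.subtype) = hdim (S ⊓ L) := by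
  have h : (S.comap L.subtype).map L.subtype = S ⊓ L := by
    rw [Submodule.map_comap_subtype, inf_comm]
  rw [hdim, hdim, ← h, (Submodule.equivMapOfInjective L.subtype L.injective_subtype
    (S.comap L.subtype)).rank_eq]

theorem coe_starProjection_comap_subtype {L S : Submodule ℂ X} [L.HasOrthogonalProjection]
    [S.HasOrthogonalProjection] [(S.comap L.subtype).HasOrthogonalProjection]
    (h : Commute L.starProjection S.starProjection) (x : L) :
    ((S.comap L.subtype).starProjection x : X) = S.starProjection x := by
  have hmem : S.starProjection (x : X) ∈ L := starProjection_mem_of_commute h.symm x.2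
  have h1 : (S.comap L.subtype).starProjection x = ⟨S.starProjection x, hmem⟩ := by
    refine Submodule.eq_starProjection_of_mem_orthogonal
      (Submodule.starProjection_apply_mem S (x : X)) ?_
    rw [Submodule.mem_orthogonal]
    intro u hu
    exact Submodule.inner_right_of_mem_orthogonal (K := S) hu
      (Submodule.sub_starProjection_mem_orthogonal (x : X))
  rw [h1]

/-- As T splits along L, a vector of S ∩ Lᗮ orthogonal to T ∩ Lᗮ is orthogonal to T; it then lies in
S ∩ Tᗮ ≤ L as well as in Lᗮ. -/
theorem inf_comap_orthogonal_eq_bot {L S T : Submodule ℂ X} [L.HasOrthogonalProjection]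
    [T.HasOrthogonalProjection] (hT : Commute L.starProjection T.starProjection)
    (h : S ⊓ Tᗮ ≤ L) : S.comap Lᗮ.subtype ⊓ (T.comap Lᗮ.subtype)ᗮ = ⊥ := by
  rw [eq_bot_iff]
  rintro x ⟨hxS, hxT⟩
  have hxT' : (x : X) ∈ Tᗮ := by
    rw [Submodule.mem_orthogonal]
    intro t ht
    have ht₂ : Lᗮ.starProjection t ∈ T := by
      rw [Submodule.starProjection_orthogonal_val]
      exact sub_mem ht (starProjection_mem_of_commute hT ht)
    rw [← Submodule.starProjection_add_starProjection_orthogonal (K := L) t, inner_add_left,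
      Submodule.inner_right_of_mem_orthogonal (Submodule.starProjection_apply_mem L t) x.2,
      zero_add]
    exact Submodule.inner_right_of_mem_orthogonal (K := T.comap Lᗮ.subtype)
      (u := ⟨_, Submodule.starProjection_apply_mem Lᗮ t⟩) ht₂ hxT
  have hxL : (x : X) ∈ L := h ⟨hxS, hxT'⟩
  have h0 : inner ℂ (x : X) x = 0 := Submodule.inner_right_of_mem_orthogonal hxL x.2
  exact Subtype.ext (inner_self_eq_zero.1 h0)

variable [CompleteSpace X]

/-- Closed subspaces `S` and `T` have a common complement if some reducing subspace `L` contains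
`S ∩ Tᗮ` and `Sᗮ ∩ T`, the operator `P_S - P_T` is bounded below on `L`, and `S ∩ L` and `T ∩ L`
have the same dimension. -/
theorem hasCommonComplement_of_reducing [TopologicalSpace.SeparableSpace X] (L S T : Submodule ℂ X)
    (hL : IsClosed (L : Set X)) (hS : IsClosed (S : Set X)) (hT : IsClosed (T : Set X))
    [L.HasOrthogonalProjection] [S.HasOrthogonalProjection] [T.HasOrthogonalProjection]
    (hLS : Commute L.starProjection S.starProjection)
    (hLT : Commute L.starProjection T.starProjection)
    (h₁ : S ⊓ Tᗮ ≤ L) (h₂ : Sᗮ ⊓ T ≤ L) {c : ℝ} (hc : 0 < c)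
    (hbelow : ∀ x ∈ L, c * ‖x‖ ≤ ‖S.starProjection x - T.starProjection x‖)
    (hdim_eq : hdim (S ⊓ L) = hdim (T ⊓ L)) : HasCommonComplement S T := by
  have : SecondCountableTopology X := UniformSpace.secondCountable_of_separable X
  have hclosed : ∀ V W : Submodule ℂ X, IsClosed (V : Set X) →
      IsClosed (V.comap W.subtype : Set W) := fun V W hV => hV.preimage W.subtypeL.continuous
  have : CompleteSpace L := hL.completeSpace_coe
  have := (hclosed S L hS).completeSpace_coe
  have := (hclosed T L hT).completeSpace_coe
  have := (hclosed S Lᗮ hS).completeSpace_coe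
  have := (hclosed T Lᗮ hT).completeSpace_coe
  refine hasCommonComplement_of_comap L S T (fun x => starProjection_mem_of_commute hLS)
    (fun x => starProjection_mem_of_commute hLT) ?_ ?_
  · refine hasCommonComplement_of_isCompl _ _ (hclosed S L hS) (hclosed T L hT) ?_ ?_
    · refine isCompl_of_starProjection_sub_bounded_below _ _ hc fun x => ?_
      have hx := hbelow x x.2
      rw [← coe_starProjection_comap_subtype hLS, ← coe_starProjection_comap_subtype hLT] at hx
      exact hx
    · rw [hdim_comap_subtype, hdim_comap_subtype, hdim_eq]
  · refine hasCommonComplement_of_inf_orthogonal_eq_bot _ _ (inf_comap_orthogonal_eq_bot hLT h₁) ?_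
    rw [inf_comm]
    exact inf_comap_orthogonal_eq_bot hLS (by rwa [inf_comm])

end Reducing

/-! ### Algebra of A = P_S - P_T and of A². -/

section ProjectionDifference

variable {X : Type*} [NormedAddCommGroup X] [InnerProductSpace ℂ X]

theorem starProjection_mul_starProjection_sub (S T : Submodule ℂ X) [S.HasOrthogonalProjection]
    [T.HasOrthogonalProjection] :
    S.starProjection * (S.starProjection - T.starProjection)
      = S.starProjection * Tᗮ.starProjection := by
  rw [Submodule.starProjection_orthogonal', mul_sub, mul_sub,
    S.isIdempotentElem_starProjection.eq, mul_one]

/-- The eigenspace of `P_S - P_T` for the eigenvalue `1` is `S ∩ Tᗮ`. -/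
theorem starProjection_sub_apply_eq_self_iff (S T : Submodule ℂ X) [S.HasOrthogonalProjection]
    [T.HasOrthogonalProjection] (x : X) :
    S.starProjection x - T.starProjection x = x ↔ x ∈ S ⊓ Tᗮ := by
  constructor
  · intro h
    -- Since ‖P_S x‖ ≤ ‖x‖, this identity forces P_T x = 0.
    have h1 : ‖S.starProjection x‖ ^ 2 - ‖T.starProjection x‖ ^ 2 = ‖x‖ ^ 2 := by
      have := congrArg (fun y => RCLike.re (inner ℂ y x)) h
      simp only [inner_sub_left, map_sub, Submodule.re_inner_starProjection_eq_normSq,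
        inner_self_eq_norm_sq] at this
      exact this
    have h2 : ‖S.starProjection x‖ ^ 2 ≤ ‖x‖ ^ 2 :=
      pow_le_pow_left₀ (norm_nonneg _) (Submodule.norm_starProjection_apply_le S x) 2
    have h3 : T.starProjection x = 0 := by
      rw [← norm_eq_zero, ← sq_eq_zero_iff]
      exact le_antisymm (by linarith) (sq_nonneg _)
    refine ⟨?_, (Submodule.starProjection_apply_eq_zero_iff _).1 h3⟩
    rw [h3, sub_zero] at h
    exact Submodule.starProjection_eq_self_iff.1 h
  · rintro ⟨hS, hT⟩
    rw [Submodule.starProjection_eq_self_iff.2 hS,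
      (Submodule.starProjection_apply_eq_zero_iff _).2 hT, sub_zero]

/-- Rests on (P_S - P_T)² = 1 - (P_S + P_T - 1)²; it makes the spectral subspaces of A² reducing. -/
theorem commute_starProjection_sub_sq (S T : Submodule ℂ X)
    [S.HasOrthogonalProjection] [T.HasOrthogonalProjection] :
    Commute ((S.starProjection - T.starProjection) * (S.starProjection - T.starProjection))
      S.starProjection := by
  have h := (commute_starProjection_add_sub_one_sq S T).symm
  have hsq : (S.starProjection - T.starProjection) * (S.starProjection - T.starProjection)
      = 1 - (S.starProjection + T.starProjection - 1) *
        (S.starProjection + T.starProjection - 1) := by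
    simp only [mul_add, add_mul, mul_sub, sub_mul, mul_one, one_mul,
      S.isIdempotentElem_starProjection.eq, T.isIdempotentElem_starProjection.eq]
    abel
  rw [hsq]
  exact (Commute.one_left _).sub_left h

theorem commute_starProjection_sub_sq_right (S T : Submodule ℂ X)
    [S.HasOrthogonalProjection] [T.HasOrthogonalProjection] :
    Commute ((S.starProjection - T.starProjection) * (S.starProjection - T.starProjection))
      T.starProjection := by
  have h := commute_starProjection_sub_sq T S
  rwa [← neg_sub S.starProjection, neg_mul_neg] at h

theorem starProjection_sub_sq_apply_of_mem (S T : Submodule ℂ X)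
    [S.HasOrthogonalProjection] [T.HasOrthogonalProjection] {x : X}
    (hx : x ∈ S ⊓ Tᗮ ∨ x ∈ Sᗮ ⊓ T) :
    ((S.starProjection - T.starProjection) * (S.starProjection - T.starProjection)) x = x := by
  rw [mul_apply_eq_comp]
  rcases hx with hx | hx
  · have h : (S.starProjection - T.starProjection) x = x :=
      (starProjection_sub_apply_eq_self_iff S T x).2 hx
    simp only [h]
  · have h : (T.starProjection - S.starProjection) x = x :=
      (starProjection_sub_apply_eq_self_iff T S x).2 (by rwa [inf_comm])
    rw [← neg_sub T.starProjection]
    simp only [neg_apply, h, map_neg, neg_neg]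

/-- If a subspace `W` on which `(P_S, P_T)` is injective and which is orthogonal to `Sᗮ ∩ T` is
contained in a reducing subspace `L` with `S ∩ L` finite-dimensional, then `W` is
finite-dimensional. -/
theorem finiteDimensional_of_inf_finiteDimensional {L S T W : Submodule ℂ X}
    [L.HasOrthogonalProjection] [S.HasOrthogonalProjection] [T.HasOrthogonalProjection]
    (hLS : Commute L.starProjection S.starProjection)
    (hLT : Commute L.starProjection T.starProjection)
    (hinj : ∀ x ∈ L, S.starProjection x = 0 → T.starProjection x = 0 → x = 0)
    (hWL : W ≤ L) (hW : W ≤ (Sᗮ ⊓ T)ᗮ) [FiniteDimensional ℂ (S ⊓ L : Submodule ℂ X)] :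
    FiniteDimensional ℂ W := by
  have hmem : ∀ x ∈ L, S.starProjection x ∈ S ⊓ L := fun x hx =>
    ⟨Submodule.starProjection_apply_mem S x, starProjection_mem_of_commute hLS.symm hx⟩
  let f : L →ₗ[ℂ] (S ⊓ L : Submodule ℂ X) :=
    (S.starProjection : X →ₗ[ℂ] X).restrict hmem
  let g : L →ₗ[ℂ] L := (T.starProjection : X →ₗ[ℂ] X).restrict
    (fun x hx => starProjection_mem_of_commute hLT.symm hx)
  let i : W →ₗ[ℂ] L := Submodule.inclusion hWL
  -- The map is x ↦ (P_S x, P_S P_T x). If P_S P_T x = 0, then P_T x ∈ Sᗮ ∩ T is orthogonal to x ∈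
  -- W, so P_T x = 0.
  refine FiniteDimensional.of_injective ((f.prod (f ∘ₗ g)) ∘ₗ i) ?_
  refine (injective_iff_map_eq_zero _).2 fun x hx => ?_
  have hx₁ : S.starProjection (x : X) = 0 :=
    congrArg (fun p : (S ⊓ L : Submodule ℂ X) × (S ⊓ L : Submodule ℂ X) => (p.1 : X)) hx
  have hx₂ : S.starProjection (T.starProjection (x : X)) = 0 :=
    congrArg (fun p : (S ⊓ L : Submodule ℂ X) × (S ⊓ L : Submodule ℂ X) => (p.2 : X)) hx
  have hx₃ : T.starProjection (x : X) = 0 := by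
    have hm : T.starProjection (x : X) ∈ Sᗮ ⊓ T :=
      ⟨(Submodule.starProjection_apply_eq_zero_iff _).1 hx₂, Submodule.starProjection_apply_mem T _⟩
    have h0 : inner ℂ (T.starProjection (x : X)) (x : X) = 0 :=
      Submodule.inner_right_of_mem_orthogonal hm (hW x.2)
    have h1 := Submodule.re_inner_starProjection_eq_normSq (K := T) (𝕜 := ℂ) (x : X)
    rw [h0, map_zero] at h1
    exact norm_eq_zero.1 (pow_eq_zero_iff two_ne_zero |>.1 h1.symm)
  exact Subtype.ext (hinj x (hWL x.2) hx₁ hx₃)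

end ProjectionDifference

/-! ### Existence of common complements. -/

section Existence

variable {X : Type*} [NormedAddCommGroup X] [InnerProductSpace ℂ X] [CompleteSpace X]

theorem isSelfAdjoint_starProjection_sub_sq (S T : Submodule ℂ X)
    [S.HasOrthogonalProjection] [T.HasOrthogonalProjection] :
    IsSelfAdjoint ((S.starProjection - T.starProjection) *
      (S.starProjection - T.starProjection)) := by
  have h := (isSelfAdjoint_starProjection S).sub (isSelfAdjoint_starProjection T)
  rw [IsSelfAdjoint, star_mul, h.star_eq]

/-- Turns spectral bounds on A² into norm bounds on A. -/
theorem re_inner_starProjection_sub_sq (S T : Submodule ℂ X)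
    [S.HasOrthogonalProjection] [T.HasOrthogonalProjection] (x : X) :
    RCLike.re (inner ℂ (((S.starProjection - T.starProjection) *
      (S.starProjection - T.starProjection)) x) x)
      = ‖S.starProjection x - T.starProjection x‖ ^ 2 := by
  have h := (isSelfAdjoint_starProjection S).sub (isSelfAdjoint_starProjection T)
  have h1 := h.isSymmetric ((S.starProjection - T.starProjection) x) x
  rw [← inner_self_eq_norm_sq (𝕜 := ℂ)]
  exact congrArg RCLike.re h1

/-- Closed subspaces `S` and `T` have a common complement if `S ∩ Tᗮ` and `Sᗮ ∩ T` have the same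
dimension. -/
theorem hasCommonComplement_of_hdim_eq [TopologicalSpace.SeparableSpace X] (S T : Submodule ℂ X)
    (hS : IsClosed (S : Set X)) (hT : IsClosed (T : Set X))
    [S.HasOrthogonalProjection] [T.HasOrthogonalProjection]
    (h : hdim (S ⊓ Tᗮ) = hdim (Sᗮ ⊓ T)) : HasCommonComplement S T := by
  set D := (S.starProjection - T.starProjection) * (S.starProjection - T.starProjection) with hD
  have hL : IsClosed ((D - 1).ker : Set X) := ContinuousLinearMap.isClosed_ker (D - 1)
  have : CompleteSpace (D - 1).ker := hL.completeSpace_coe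
  have hmem : ∀ x, x ∈ (D - 1).ker ↔ D x = x := fun x => by
    rw [LinearMap.mem_ker, ContinuousLinearMap.coe_coe, sub_apply, one_apply_eq_self, sub_eq_zero]
  have hcomm : ∀ C : X →L[ℂ] X, IsSelfAdjoint C → Commute D C →
      Commute (D - 1).ker.starProjection C := by
    intro C hC hDC
    refine hC.commute_starProjection_of_invariant _ fun x hx => ?_
    rw [hmem] at hx ⊢
    have := congrArg (fun f : X →L[ℂ] X => f x) hDC.eq
    simp only [mul_apply_eq_comp, hx] at this
    exact this
  have hnorm : ∀ x ∈ (D - 1).ker, ‖S.starProjection x - T.starProjection x‖ = ‖x‖ := by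
    intro x hx
    rw [← sq_eq_sq₀ (norm_nonneg _) (norm_nonneg _), ← re_inner_starProjection_sub_sq, ← hD,
      (hmem x).1 hx, inner_self_eq_norm_sq]
  -- For x ∈ U ∩ ker(D - 1), ‖x - P_V x‖ = ‖x‖ puts x in Vᗮ. So ker(D - 1) meets S in S ∩ Tᗮ and T
  -- in T ∩ Sᗮ.
  have hinf : ∀ (U V : Submodule ℂ X) [U.HasOrthogonalProjection] [V.HasOrthogonalProjection],
      (∀ x ∈ (D - 1).ker, ‖U.starProjection x - V.starProjection x‖ = ‖x‖) →
      (∀ x ∈ U ⊓ Vᗮ, D x = x) → U ⊓ (D - 1).ker = U ⊓ Vᗮ := by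
    intro U V _ _ hn hfix
    refine le_antisymm (fun x hx => ⟨hx.1, ?_⟩) fun x hx => ⟨hx.1, (hmem x).2 (hfix x hx)⟩
    have h1 := hn x hx.2
    rw [Submodule.starProjection_eq_self_iff.2 hx.1,
      ← Submodule.starProjection_orthogonal_val] at h1
    exact (Submodule.mem_iff_norm_starProjection Vᗮ x).2 h1
  have hfix₁ : ∀ x ∈ S ⊓ Tᗮ, D x = x := fun x hx =>
    starProjection_sub_sq_apply_of_mem S T (.inl hx)
  have hfix₂ : ∀ x ∈ T ⊓ Sᗮ, D x = x := fun x hx =>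
    starProjection_sub_sq_apply_of_mem S T (.inr (by rwa [inf_comm]))
  refine hasCommonComplement_of_reducing (D - 1).ker S T hL hS hT
    (hcomm _ (isSelfAdjoint_starProjection S) (commute_starProjection_sub_sq S T))
    (hcomm _ (isSelfAdjoint_starProjection T) (commute_starProjection_sub_sq_right S T))
    (fun x hx => (hmem x).2 (hfix₁ x hx)) (fun x hx => (hmem x).2 (hfix₂ x (by rwa [inf_comm])))
    one_pos (fun x hx => by rw [one_mul, hnorm x hx]) ?_
  rw [hinf S T hnorm hfix₁, hinf T S (fun x hx => by rw [norm_sub_rev, hnorm x hx]) hfix₂, h,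
    inf_comm]

/-- If `W` is invariant under the projections onto the spectral subspaces of `(P_S - P_T)²` away
from zero and meets each of them in a finite-dimensional subspace, then `P_S - P_T` is compact on
`W`. -/
theorem isCompactOperator_of_finiteDimensional_inf_nonnegSpace (S T W : Submodule ℂ X)
    [S.HasOrthogonalProjection] [T.HasOrthogonalProjection]
    (hfin : ∀ δ : ℝ, 0 < δ → δ < 1 → FiniteDimensional ℂ
      (W ⊓ nonnegSpace ((S.starProjection - T.starProjection) *
        (S.starProjection - T.starProjection) - (δ : ℂ) • 1) : Submodule ℂ X))
    (hinv : ∀ δ : ℝ, 0 < δ → δ < 1 → ∀ x ∈ W,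
      (nonnegSpace ((S.starProjection - T.starProjection) *
        (S.starProjection - T.starProjection) - (δ : ℂ) • 1)).starProjection x ∈ W) :
    IsCompactOperator ((S.starProjection - T.starProjection) ∘L W.subtypeL) := by
  set A := S.starProjection - T.starProjection with hA
  have hcl := isClosed_setOfPred_isCompactOperator (σ₁₂ := RingHom.id ℂ) (M₁ := W) (M₂ := X)
  refine hcl.closure_subset (Metric.mem_closure_iff.2 fun ε hε => ?_)
  -- With V the spectral subspace of A² for [η², ∞), ‖Ay‖ ≤ η‖y‖ on Vᗮ. So A P_V, of finite rank on
  -- W, is within η of A there.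
  obtain ⟨η, hη, hηε, hη1⟩ : ∃ η : ℝ, 0 < η ∧ η < ε ∧ η < 1 :=
    ⟨min ε 1 / 2, by positivity, by linarith [min_le_left ε 1, lt_min hε one_pos],
      by linarith [min_le_right ε 1, lt_min hε one_pos]⟩
  have hδ0 : 0 < η ^ 2 := by positivity
  have hδ1 : η ^ 2 < 1 := by nlinarith
  set D := A * A - ((η ^ 2 : ℝ) : ℂ) • 1 with hD
  have hDsa : IsSelfAdjoint D := by
    refine (isSelfAdjoint_starProjection_sub_sq S T).sub ?_
    rw [IsSelfAdjoint, star_smul, star_one]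
    congr 1
    exact Complex.conj_ofReal _
  set V := nonnegSpace D
  have : FiniteDimensional ℂ (W ⊓ V : Submodule ℂ X) := hfin _ hδ0 hδ1
  let p : W →L[ℂ] (W ⊓ V : Submodule ℂ X) := (V.starProjection ∘L W.subtypeL).codRestrict _
    fun x => ⟨hinv _ hδ0 hδ1 x x.2, Submodule.starProjection_apply_mem V _⟩
  have : LocallyCompactSpace (W ⊓ V : Submodule ℂ X) := .of_finiteDimensional_of_complete ℂ _
  refine ⟨(A ∘L (W ⊓ V).subtypeL) ∘L p,
    (isCompactOperator_of_locallyCompactSpace_dom p).clm_comp (A ∘L (W ⊓ V).subtypeL), ?_⟩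
  rw [dist_eq_norm]
  refine lt_of_le_of_lt (ContinuousLinearMap.opNorm_le_bound _ hη.le fun x => ?_) hηε
  have hx : (A ∘L W.subtypeL - (A ∘L (W ⊓ V).subtypeL) ∘L p) x = A (Vᗮ.starProjection (x : X)) := by
    rw [Submodule.starProjection_orthogonal_val, map_sub]
    rfl
  set y := Vᗮ.starProjection (x : X) with hy
  have h1 := re_inner_nonpos_of_mem_nonnegSpace_orthogonal hDsa
    (Submodule.starProjection_apply_mem Vᗮ (x : X))
  rw [← hy, hD, sub_apply, inner_sub_left, map_sub, re_inner_starProjection_sub_sq, smul_apply,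
    one_apply_eq_self, inner_smul_left, Complex.conj_ofReal, ← Complex.coe_algebraMap,
    RCLike.re_ofReal_mul, inner_self_eq_norm_sq, sub_nonpos, ← mul_pow] at h1
  rw [hx]
  calc ‖A y‖ ≤ η * ‖y‖ := le_of_sq_le_sq h1 (by positivity)
    _ ≤ η * ‖x‖ := by gcongr; exact Submodule.norm_starProjection_apply_le _ _

/-- Closed subspaces `S` and `T` have a common complement if `P_S - P_T` is not compact on the
orthogonal complement of `S ∩ Tᗮ ⊔ Sᗮ ∩ T`. -/
theorem hasCommonComplement_of_not_isCompactOperator [TopologicalSpace.SeparableSpace X]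
    (S T : Submodule ℂ X) (hS : IsClosed (S : Set X)) (hT : IsClosed (T : Set X))
    [S.HasOrthogonalProjection] [T.HasOrthogonalProjection]
    (h : ¬ IsCompactOperator ((S.starProjection - T.starProjection) ∘L
      (S ⊓ Tᗮ ⊔ Sᗮ ⊓ T)ᗮ.subtypeL)) : HasCommonComplement S T := by
  set W := (S ⊓ Tᗮ ⊔ Sᗮ ⊓ T)ᗮ
  set A := S.starProjection - T.starProjection with hA
  have hsa : ∀ δ : ℝ, IsSelfAdjoint (A * A - (δ : ℂ) • 1) := fun δ => by
    refine (isSelfAdjoint_starProjection_sub_sq S T).sub ?_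
    rw [IsSelfAdjoint, star_smul, star_one]
    congr 1
    exact Complex.conj_ofReal _
  -- A² is the identity on both eigenspaces, which therefore have eigenvalue 1 - δ > 0 here.
  have hle : ∀ δ : ℝ, δ < 1 → S ⊓ Tᗮ ⊔ Sᗮ ⊓ T ≤ nonnegSpace (A * A - (δ : ℂ) • 1) := by
    intro δ hδ
    have key : ∀ x, x ∈ S ⊓ Tᗮ ∨ x ∈ Sᗮ ⊓ T → x ∈ nonnegSpace (A * A - (δ : ℂ) • 1) := by
      intro x hx
      refine mem_nonnegSpace_of_apply_eq_smul (hsa δ) (r := 1 - δ) (by linarith) ?_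
      rw [sub_apply, starProjection_sub_sq_apply_of_mem S T hx, smul_apply, one_apply_eq_self]
      push_cast
      rw [sub_smul, one_smul]
    exact sup_le (fun x hx => key x (.inl hx)) fun x hx => key x (.inr hx)
  by_cases hfin : ∀ δ : ℝ, 0 < δ → δ < 1 → FiniteDimensional ℂ
      (W ⊓ nonnegSpace (A * A - (δ : ℂ) • 1) : Submodule ℂ X)
  · refine absurd (isCompactOperator_of_finiteDimensional_inf_nonnegSpace S T W hfin ?_) h
    intro δ _ hδ x hx
    rw [Submodule.mem_orthogonal]
    intro u hu
    rw [← Submodule.inner_starProjection_left_eq_right,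
      Submodule.starProjection_eq_self_iff.2 (hle δ hδ hu)]
    exact Submodule.inner_right_of_mem_orthogonal hu hx
  · push Not at hfin
    obtain ⟨δ, hδ0, hδ1, hinf⟩ := hfin
    set L := nonnegSpace (A * A - (δ : ℂ) • 1)
    have hcomm : ∀ C : X →L[ℂ] X, IsSelfAdjoint C → Commute (A * A) C →
        Commute L.starProjection C := fun C hC hAC =>
      hC.commute_starProjection_nonnegSpace (hAC.sub_left ((Commute.one_left C).smul_left _))
    have hLS := hcomm _ (isSelfAdjoint_starProjection S) (commute_starProjection_sub_sq S T)
    have hLT := hcomm _ (isSelfAdjoint_starProjection T) (commute_starProjection_sub_sq_right S T)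
    have hbelow : ∀ x ∈ L, √δ * ‖x‖ ≤ ‖S.starProjection x - T.starProjection x‖ := by
      intro x hx
      have h1 := re_inner_nonneg_of_mem_nonnegSpace (hsa δ) hx
      rw [sub_apply, inner_sub_left, map_sub, re_inner_starProjection_sub_sq, smul_apply,
        one_apply_eq_self, inner_smul_left, Complex.conj_ofReal, ← Complex.coe_algebraMap,
        RCLike.re_ofReal_mul, inner_self_eq_norm_sq, sub_nonneg] at h1
      refine le_of_sq_le_sq ?_ (norm_nonneg _)
      rwa [mul_pow, Real.sq_sqrt hδ0.le]
    have hsqrt : 0 < √δ := Real.sqrt_pos.2 hδ0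
    have hinj : ∀ x ∈ L, S.starProjection x = 0 → T.starProjection x = 0 → x = 0 := by
      intro x hx h1 h2
      have h3 := hbelow x hx
      rw [h1, h2, sub_self, norm_zero] at h3
      exact norm_le_zero_iff.1 (nonpos_of_mul_nonpos_right h3 hsqrt)
    -- W ∩ L embeds in two copies of S ∩ L, and likewise of T ∩ L, so both have dimension `⊤`.
    have hSinf : ¬ FiniteDimensional ℂ (S ⊓ L : Submodule ℂ X) := fun _ => hinf
      (finiteDimensional_of_inf_finiteDimensional hLS hLT hinj inf_le_right
        (inf_le_left.trans (Submodule.orthogonal_le le_sup_right)))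
    have hTinf : ¬ FiniteDimensional ℂ (T ⊓ L : Submodule ℂ X) := fun _ => hinf
      (finiteDimensional_of_inf_finiteDimensional hLT hLS (fun x hx h1 h2 => hinj x hx h2 h1)
        inf_le_right (inf_le_left.trans (Submodule.orthogonal_le
          ((inf_comm Tᗮ S).le.trans le_sup_left))))
    refine hasCommonComplement_of_reducing L S T (isClosed_nonnegSpace _) hS hT hLS hLT
      (le_sup_left.trans (hle δ hδ1)) (le_sup_right.trans (hle δ hδ1)) hsqrt hbelow ?_
    rw [(hdim_eq_top_iff _).2 hSinf, (hdim_eq_top_iff _).2 hTinf]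

end Existence

/-! ### The index obstruction. -/

section Obstruction

variable {X : Type*} [NormedAddCommGroup X] [InnerProductSpace ℂ X] [CompleteSpace X]

/-- If `S` and `T` have a common complement and `P_S P_{Tᗮ}` is compact, then `S ∩ Tᗮ` and
`Sᗮ ∩ T` have the same dimension. -/
theorem HasCommonComplement.hdim_eq {S T : Submodule ℂ X} (h : HasCommonComplement S T)
    (hS : IsClosed (S : Set X)) (hT : IsClosed (T : Set X))
    [S.HasOrthogonalProjection] [T.HasOrthogonalProjection]
    (hcomp : IsCompactOperator (S.starProjection * Tᗮ.starProjection)) :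
    hdim (S ⊓ Tᗮ) = hdim (Sᗮ ⊓ T) := by
  have : CompleteSpace S := hS.completeSpace_coe
  have : CompleteSpace T := hT.completeSpace_coe
  obtain ⟨Z, hZ, hSZ, hTZ⟩ := h
  let q : X →L[ℂ] T := T.projectionOntoL Z (Submodule.IsCompl.isTopCompl_of_isClosed hTZ hT hZ)
  have hqT : ∀ t : T, q t = t := fun t => Submodule.projectionOntoL_apply_left _ t
  have hqker : ∀ x, q x = 0 ↔ x ∈ Z := fun x => Submodule.projectionOntoL_apply_eq_zero_iff _
  have hbij : Function.Bijective (q ∘L S.subtypeL) := by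
    constructor
    · refine (injective_iff_map_eq_zero _).2 fun s hs => Subtype.ext ?_
      exact Submodule.disjoint_def.1 hSZ.disjoint _ s.2 ((hqker _).1 hs)
    · intro t
      obtain ⟨s, hs, z, hz, hsz⟩ := Submodule.mem_sup.1
        (hSZ.sup_eq_top ▸ Submodule.mem_top : (t : X) ∈ S ⊔ Z)
      refine ⟨⟨s, hs⟩, ?_⟩
      have h1 := hqT t
      rw [← hsz, map_add, (hqker z).2 hz, add_zero] at h1
      exact h1
  let e : S ≃L[ℂ] T := ContinuousLinearEquiv.ofBijective (q ∘L S.subtypeL)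
    (LinearMap.ker_eq_bot.2 hbij.1) (LinearMap.range_eq_top.2 hbij.2)
  have hK₀ : IsCompactOperator (Tᗮ.starProjection * S.starProjection) := by
    have h1 := hcomp.adjoint
    rwa [← ContinuousLinearMap.star_eq_adjoint, star_mul,
      (isSelfAdjoint_starProjection S).star_eq, (isSelfAdjoint_starProjection Tᗮ).star_eq] at h1
  -- Chosen so that e - K is s ↦ q(s - P_Tᗮ s) = P_T s, the compression whose kernel and cokernel
  -- are the two intersections.
  let K : S →L[ℂ] T := (q ∘L (Tᗮ.starProjection * S.starProjection)) ∘L S.subtypeL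
  have hK : IsCompactOperator K := (hK₀.clm_comp q).comp_clm S.subtypeL
  have hC : ∀ s : S, (((e : S →L[ℂ] T) - K) s : X) = T.starProjection (s : X) := by
    intro s
    have h1 : K s = q (Tᗮ.starProjection (s : X)) := by
      change q (Tᗮ.starProjection (S.starProjection (s : X))) = _
      rw [Submodule.starProjection_eq_self_iff.2 s.2]
    have h2 : (e : S →L[ℂ] T) s = q (s : X) := rfl
    rw [sub_apply, h1, h2, ← map_sub, Submodule.starProjection_orthogonal_val, sub_sub_cancel]
    exact congrArg Subtype.val (hqT ⟨_, Submodule.starProjection_apply_mem T (s : X)⟩)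
  have hindex := hK.rank_ker_equiv_sub_eq e
  have hker : ((e : S →L[ℂ] T) - K).ker = (Tᗮ).comap S.subtype := by
    ext s
    rw [LinearMap.mem_ker, ContinuousLinearMap.coe_coe, ← Subtype.coe_inj, hC, Submodule.mem_comap,
      ← Submodule.starProjection_apply_eq_zero_iff]
    rfl
  have hrange : ((e : S →L[ℂ] T) - K).rangeᗮ = (Sᗮ).comap T.subtype := by
    ext t
    rw [Submodule.mem_orthogonal, Submodule.mem_comap, Submodule.mem_orthogonal]
    have key : ∀ s : S, inner ℂ (((e : S →L[ℂ] T) - K) s) t = inner ℂ (s : X) (t : X) := by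
      intro s
      rw [Submodule.coe_inner, hC, Submodule.inner_starProjection_left_eq_right,
        Submodule.starProjection_eq_self_iff.2 t.2]
    constructor
    · intro h u hu
      rw [← h _ ⟨⟨u, hu⟩, rfl⟩]
      exact (key ⟨u, hu⟩).symm
    · rintro h _ ⟨s, rfl⟩
      exact (key s).trans (h s s.2)
  rw [hker, hrange] at hindex
  rw [inf_comm, ← hdim_comap_subtype, ← hdim_comap_subtype, hdim, hdim, hindex]

/-- If `S ∩ Tᗮ` is finite-dimensional and `P_S - P_T` is compact on the orthogonal complement of
`S ∩ Tᗮ ⊔ Sᗮ ∩ T`, then `P_S P_{Tᗮ}` is compact. -/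
theorem isCompactOperator_starProjection_mul {S T : Submodule ℂ X} [S.HasOrthogonalProjection]
    [T.HasOrthogonalProjection] [FiniteDimensional ℂ (S ⊓ Tᗮ : Submodule ℂ X)]
    (h : IsCompactOperator ((S.starProjection - T.starProjection) ∘L
      (S ⊓ Tᗮ ⊔ Sᗮ ⊓ T)ᗮ.subtypeL)) :
    IsCompactOperator (S.starProjection * Tᗮ.starProjection) := by
  have hclosed : IsClosed ((Sᗮ ⊓ T : Submodule ℂ X) : Set X) := by
    have hT : IsClosed (T : Set X) := by
      rw [← Submodule.orthogonal_orthogonal T]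
      exact Submodule.isClosed_orthogonal _
    exact (Submodule.isClosed_orthogonal S).inter hT
  have : CompleteSpace (Sᗮ ⊓ T : Submodule ℂ X) := hclosed.completeSpace_coe
  set M := S ⊓ Tᗮ
  set N := Sᗮ ⊓ T
  set A := S.starProjection - T.starProjection with hA
  -- Split X into M, N and (M ⊔ N)ᗮ: P_S A has finite rank on M, vanishes on N where A = -1, and is
  -- compact on the rest.
  rw [← starProjection_mul_starProjection_sub, ← hA]
  have hMN : M ⟂ N := by
    rw [Submodule.isOrtho_iff_inner_eq]
    intro u hu v hv
    exact Submodule.inner_right_of_mem_orthogonal hu.1 hv.1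
  have hmem : ∀ x, x - M.starProjection x - N.starProjection x ∈ (M ⊔ N)ᗮ := by
    intro x
    rw [← Submodule.inf_orthogonal]
    refine ⟨sub_mem (Submodule.sub_starProjection_mem_orthogonal x)
      (hMN.symm (Submodule.starProjection_apply_mem N x)), ?_⟩
    rw [sub_right_comm]
    exact sub_mem (Submodule.sub_starProjection_mem_orthogonal x)
      (hMN (Submodule.starProjection_apply_mem M x))
  let r : X →L[ℂ] (M ⊔ N)ᗮ := (1 - M.starProjection - N.starProjection).codRestrict _ hmem
  have h1 : IsCompactOperator (((S.starProjection * A) ∘L M.starProjection)) :=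
    isCompactOperator_comp_starProjection M _
  have h2 := (h.comp_clm r).clm_comp S.starProjection
  refine Eq.mpr (congrArg IsCompactOperator (funext fun x => ?_)) (h2.add h1)
  have hN : S.starProjection (A (N.starProjection x)) = 0 := by
    have hx := Submodule.starProjection_apply_mem N x
    have h3 : (T.starProjection - S.starProjection) (N.starProjection x) = N.starProjection x :=
      (starProjection_sub_apply_eq_self_iff T S _).2 ⟨hx.2, hx.1⟩
    rw [hA, ← neg_sub T.starProjection, neg_apply, h3, map_neg, neg_eq_zero]
    exact (Submodule.starProjection_apply_eq_zero_iff _).2 hx.1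
  change S.starProjection (A x) = S.starProjection (A (x - M.starProjection x - N.starProjection x))
    + S.starProjection (A (M.starProjection x))
  rw [map_sub, map_sub, map_sub, map_sub, hN]
  abel

/-- If `S ∩ Tᗮ` and `Sᗮ ∩ T` have different dimensions and `P_S - P_T` is compact on the orthogonal
complement of `S ∩ Tᗮ ⊔ Sᗮ ∩ T`, then `P_S P_{Tᗮ}` or `P_T P_{Sᗮ}` is compact. -/
theorem isCompactOperator_starProjection_mul_or {S T : Submodule ℂ X} [S.HasOrthogonalProjection]
    [T.HasOrthogonalProjection] (hne : hdim (S ⊓ Tᗮ) ≠ hdim (Sᗮ ⊓ T))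
    (h : IsCompactOperator ((S.starProjection - T.starProjection) ∘L
      (S ⊓ Tᗮ ⊔ Sᗮ ⊓ T)ᗮ.subtypeL)) :
    IsCompactOperator (S.starProjection * Tᗮ.starProjection) ∨
      IsCompactOperator (T.starProjection * Sᗮ.starProjection) := by
  by_cases hM : FiniteDimensional ℂ (S ⊓ Tᗮ : Submodule ℂ X)
  · exact .inl (isCompactOperator_starProjection_mul h)
  · have hN : FiniteDimensional ℂ (T ⊓ Sᗮ : Submodule ℂ X) := by
      by_contra hN
      rw [inf_comm] at hN
      exact hne (((hdim_eq_top_iff _).2 hM).trans ((hdim_eq_top_iff _).2 hN).symm)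
    refine .inr (isCompactOperator_starProjection_mul ?_)
    have hcompl : T ⊓ Sᗮ ⊔ Tᗮ ⊓ S = S ⊓ Tᗮ ⊔ Sᗮ ⊓ T := by
      rw [sup_comm, inf_comm, inf_comm T]
    rw [hcompl, ← neg_sub, ContinuousLinearMap.neg_comp]
    exact h.neg

end Obstruction

/-! ### Closing the cycle of implications. -/

theorem mainTheorem5 {H : Type*} [NormedAddCommGroup H] [InnerProductSpace ℂ H]
    [CompleteSpace H] [TopologicalSpace.SeparableSpace H] (S T : ClosedSubmodule ℂ H) :
    (¬ HasCommonComplement S.toSubmodule T.toSubmodule ↔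
      hdim (projDiff S T - 1).ker ≠ hdim (projDiff S T + 1).ker ∧
      IsCompactOperator (fun x : eigenCompl (projDiff S T) => projDiff S T (x : H))) ∧
    (¬ HasCommonComplement S.toSubmodule T.toSubmodule ↔
      hdim (S.toSubmodule ⊓ T.toSubmoduleᗮ) ≠ hdim (S.toSubmoduleᗮ ⊓ T.toSubmodule) ∧
      (IsCompactOperator (orthProj S * orthProj Tᗮ) ∨
        IsCompactOperator (orthProj T * orthProj Sᗮ))) := by
  have : CompleteSpace S.toSubmodule := S.isClosed.completeSpace_coe
  have : CompleteSpace T.toSubmodule := T.isClosed.completeSpace_coe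
  have hA : projDiff S T = S.toSubmodule.starProjection - T.toSubmodule.starProjection := rfl
  have hPS : orthProj S * orthProj Tᗮ
      = S.toSubmodule.starProjection * T.toSubmoduleᗮ.starProjection := rfl
  have hPT : orthProj T * orthProj Sᗮ
      = T.toSubmodule.starProjection * S.toSubmoduleᗮ.starProjection := rfl
  have hker₁ : (projDiff S T - 1).ker = S.toSubmodule ⊓ T.toSubmoduleᗮ := by
    ext x
    rw [← starProjection_sub_apply_eq_self_iff, ← sub_eq_zero]
    rfl
  have hker₂ : (projDiff S T + 1).ker = S.toSubmoduleᗮ ⊓ T.toSubmodule := by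
    ext x
    rw [inf_comm, ← starProjection_sub_apply_eq_self_iff, ← neg_sub, neg_eq_iff_add_eq_zero]
    rfl
  have hcompl : eigenCompl (projDiff S T) =
      (S.toSubmodule ⊓ T.toSubmoduleᗮ ⊔ S.toSubmoduleᗮ ⊓ T.toSubmodule)ᗮ := by
    rw [eigenCompl, hker₁, hker₂]
  have hcomp : IsCompactOperator (fun x : eigenCompl (projDiff S T) => projDiff S T (x : H)) ↔
      IsCompactOperator ((S.toSubmodule.starProjection - T.toSubmodule.starProjection) ∘L
        (S.toSubmodule ⊓ T.toSubmoduleᗮ ⊔ S.toSubmoduleᗮ ⊓ T.toSubmodule)ᗮ.subtypeL) := by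
    rw [hcompl]
    rfl
  rw [hcomp, hker₁, hker₂, hPS, hPT]
  have hnone : ¬ HasCommonComplement S.toSubmodule T.toSubmodule →
      hdim (S.toSubmodule ⊓ T.toSubmoduleᗮ) ≠ hdim (S.toSubmoduleᗮ ⊓ T.toSubmodule) ∧
      IsCompactOperator ((S.toSubmodule.starProjection - T.toSubmodule.starProjection) ∘L
        (S.toSubmodule ⊓ T.toSubmoduleᗮ ⊔ S.toSubmoduleᗮ ⊓ T.toSubmodule)ᗮ.subtypeL) :=
    fun h => ⟨fun hd => h (hasCommonComplement_of_hdim_eq _ _ S.isClosed T.isClosed hd),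
      not_not.1 fun hc => h (hasCommonComplement_of_not_isCompactOperator _ _
        S.isClosed T.isClosed hc)⟩
  have hprod := isCompactOperator_starProjection_mul_or (S := S.toSubmodule) (T := T.toSubmodule)
  have hobs : hdim (S.toSubmodule ⊓ T.toSubmoduleᗮ) ≠ hdim (S.toSubmoduleᗮ ⊓ T.toSubmodule) →
      (IsCompactOperator (S.toSubmodule.starProjection * T.toSubmoduleᗮ.starProjection) ∨
        IsCompactOperator (T.toSubmodule.starProjection * S.toSubmoduleᗮ.starProjection)) →
      ¬ HasCommonComplement S.toSubmodule T.toSubmodule := by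
    rintro hd (hc | hc) h
    · exact hd (h.hdim_eq S.isClosed T.isClosed hc)
    · have := h.symm.hdim_eq T.isClosed S.isClosed hc
      rw [inf_comm, inf_comm T.toSubmoduleᗮ] at this
      exact hd this.symm
  exact ⟨⟨hnone, fun h => hobs h.1 (hprod h.1 h.2)⟩,
    ⟨fun h => ⟨(hnone h).1, hprod (hnone h).1 (hnone h).2⟩, fun h => hobs h.1 h.2⟩⟩
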